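/- **Definitions.** A *normalized Gaussian tree* on a finite vertex set $V$ with $|V|=N$ is a tree with vertex set $V$ together with a weight $w_{ij}\in(-1,1)$ on each edge $ij$. Its covariance matrix $\Sigma=(\sigma_{ij})$ has $\sigma_{ii}=1$ and, for $i\ne j$, $\sigma_{ij}$ is the product of the weights along the unique path from $i$ to $j$. For covariance matrices $A,B$ put $$D(A\|B)=\tfrac12\log\frac{|B|}{|A|}+\tfrac12\operatorname{tr}(B^{-1}A)-\tfrac N2 ,$$ the Kullback–Leibler divergence of $N(0,A)$ from $N(0,B)$. For $\Sigma_1,\Sigma_2$ and $\lambda\in[0,1]$ let $\Sigma_\lambda^{-1}=\lambda\Sigma_1^{-1}+(1-\lambda)\Sigma_2^{-1}$; an *optimal Chernoff parameter* $\lambda^*$ is a point $\lambda\in[0,1]$ at which $D(\Sigma_{\lambda}\|\Sigma_2)=D(\Sigma_{\lambda}\|\Sigma_1)$ (it is unique if $\Sigma_1\neq\Sigma_2$). A *grafting operation* with anchor nodes $i,p,q$ ($p\neq q$) turns a Gaussian tree containing the edge $ip$ into the one in which $ip$ is replaced by the edge $iq$ with the same weight, all the other edges and weights being kept, where $q$ lies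 in the component of $p$ after the cut, so that the result is again a tree. Grafting operations $(i_k,p_k,q_k)$, $k=1,\dots,n$, performed successively from a tree $T$, are *independent* if $V$ can be partitioned into a center $C$ and super leaf nodes $S_1,\dots,S_m$ such that $C$ and every $S_l$ induce (nonempty) connected subtrees of $T$, no edge of $T$ joins two different super leaf nodes, every operation is of one of the types 1. $i_k,p_k,q_k\in S_l$ for some $l$; 2. $i_k\in C$ and $p_k,q_k\in S_l$ for some $l$; 3. $i_k,p_k\in S_l$ and $q_k\in S_{l'}$ for some $l\neq l'$; and no super leaf node contains anchor nodes of two different operations. **Proposition 7.** Let $T_1\leftrightarrow T_2\leftrightarrow\dots\leftrightarrow T_{n+1}$ be a chain of normalized Gaussian trees in which $T_{k+1}$ is obtained from $T_k$ by the $k$-th grafting operation, and suppose that these $n$ operations are independent (with respect to $T_1$). Let $\Sigma_1,\Sigma_2$ be the covariance matrices of the first tree $T_1$ and the last tree $T_{n+1}$. Then $\lambda=\tfrac12$ is an optimal Chernoff parameter of $\Sigma_1,\Sigma_2$, i.e. $D(\Sigma_{1/2}\|\Sigma_2)=D(\Sigma_{1/2}\|\Sigma_1)$. If at least one of the moved edges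 has nonzero weight, it is the only one: $\lambda^*=\tfrac12$. -/

import Mathlib

/-- A normalized Gaussian tree on the vertex set `V`: a tree together with a correlation
`weight s(i, j) ∈ (-1, 1)` on every edge. Values of `weight` off the edge set are irrelevant. -/
structure GaussianTree (V : Type*) where
  graph : SimpleGraph V
  isTree : graph.IsTree
  weight : Sym2 V → ℝ
  abs_weight_lt_one : ∀ e ∈ graph.edgeSet, |weight e| < 1

namespace GaussianTree

variable {V : Type*}

/-- The unique path from `i` to `j` in the tree. -/
noncomputable def path (T : GaussianTree V) (i j : V) : T.graph.Walk i j :=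
  (T.isTree.existsUnique_path i j).choose

/-- The normalized covariance matrix: the entry `(i, j)` is the product of the weights along the
unique path from `i` to `j`; in particular it is `1` for `i = j`, and the weight of the edge if
`i` and `j` are adjacent. -/
noncomputable def cov (T : GaussianTree V) : Matrix V V ℝ :=
  Matrix.of fun i j => ((T.path i j).edges.map T.weight).prod

end GaussianTree

section Chernoff

variable {V : Type*} [Fintype V] [DecidableEq V]

/-- Kullback-Leibler divergence `D(N(0, A) || N(0, B))` of centred Gaussian distributions with
covariance matrices `A` and `B`. -/
noncomputable def gaussianKL (A B : Matrix V V ℝ) : ℝ :=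
  1 / 2 * Real.log (B.det / A.det) + 1 / 2 * (B⁻¹ * A).trace - (Fintype.card V : ℝ) / 2

/-- The covariance matrix `Σ_t`, where `Σ_t⁻¹ = t Σ₁⁻¹ + (1 - t) Σ₂⁻¹`. -/
noncomputable def tiltedCov (S₁ S₂ : Matrix V V ℝ) (t : ℝ) : Matrix V V ℝ :=
  (t • S₁⁻¹ + (1 - t) • S₂⁻¹)⁻¹

/-- `t ∈ [0, 1]` is an optimal Chernoff parameter of `N(0, Σ₁)` and `N(0, Σ₂)`:
`D(Σ_t || Σ₂) = D(Σ_t || Σ₁)`. -/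
def IsChernoffParameter (S₁ S₂ : Matrix V V ℝ) (t : ℝ) : Prop :=
  t ∈ Set.Icc (0 : ℝ) 1 ∧
    gaussianKL (tiltedCov S₁ S₂ t) S₂ = gaussianKL (tiltedCov S₁ S₂ t) S₁

end Chernoff

/-- The anchor nodes `i, p, q` of a grafting operation: the edge `i - p` is cut and the subtree
containing `i` is pasted to `q` by a new edge `i - q`. -/
structure Graft (V : Type*) where
  i : V
  p : V
  q : V

/-- `T'` is obtained from `T` by the grafting operation `g`: the edge `i - p` of `T` is replaced by
the edge `i - q`, which inherits its weight, and all the other edges keep their weights.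
As `T'` is a tree, `q` lies in the component of `p` after the cut. -/
structure IsGraft {V : Type*} (T T' : GaussianTree V) (g : Graft V) : Prop where
  adj : T.graph.Adj g.i g.p
  ne : g.p ≠ g.q
  graph_eq : T'.graph = T.graph.deleteEdges {s(g.i, g.p)} ⊔ SimpleGraph.edge g.i g.q
  weight_new : T'.weight s(g.i, g.q) = T.weight s(g.i, g.p)
  weight_old : ∀ e ∈ T.graph.edgeSet, e ≠ s(g.i, g.p) → T'.weight e = T.weight e

/-- The graph `G` is star-shaped after regrouping its nodes: `part v = none` says that `v` belongs to
the subtree in the center, `part v = some l` that it belongs to the super leaf node `l`. The center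
and the super leaf nodes are connected, and there is no edge between two different super leaf nodes.
(If `G` is a tree, then each super leaf node is joined to the center by exactly one edge.) -/
structure IsStarShaped {V : Type*} (G : SimpleGraph V) {m : ℕ} (part : V → Option (Fin m)) :
    Prop where
  center_connected : (G.induce {v | part v = none}).Connected
  leaf_connected : ∀ l : Fin m, (G.induce {v | part v = some l}).Connected
  leaf_separate : ∀ u v : V, ∀ l l' : Fin m,
    part u = some l → part v = some l' → G.Adj u v → l = l'

namespace Graft

variable {V : Type*} {m : ℕ}

/-- Within a super leaf node, a subtree is cut and pasted to another part of this super leaf node. -/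
def IsTypeOne (g : Graft V) (part : V → Option (Fin m)) : Prop :=
  ∃ l, part g.i = some l ∧ part g.p = some l ∧ part g.q = some l

/-- The part of the tree outside a super leaf node is cut from it and pasted to another
location in this super leaf node. -/
def IsTypeTwo (g : Graft V) (part : V → Option (Fin m)) : Prop :=
  ∃ l, part g.i = none ∧ part g.p = some l ∧ part g.q = some l

/-- A subtree is cut from a super leaf node and pasted to another super leaf node. -/
def IsTypeThree (g : Graft V) (part : V → Option (Fin m)) : Prop :=
  ∃ l l', l ≠ l' ∧ part g.i = some l ∧ part g.p = some l ∧ part g.q = some l'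

/-- The super leaf nodes involved in a grafting operation. -/
def leaves (g : Graft V) (part : V → Option (Fin m)) : Set (Fin m) :=
  {l | part g.i = some l ∨ part g.p = some l ∨ part g.q = some l}

end Graft

/-- The grafting operations `g k` on the tree `T` are independent: `T` is star-shaped for some
grouping of its nodes such that every operation is of one of the three types and different operations
involve disjoint sets of super leaf nodes. -/
def AreIndependent {V : Type*} {n : ℕ} (T : GaussianTree V) (g : Fin n → Graft V) : Prop :=
  ∃ (m : ℕ) (part : V → Option (Fin m)),
    IsStarShaped T.graph part ∧
    (∀ k, (g k).IsTypeOne part ∨ (g k).IsTypeTwo part ∨ (g k).IsTypeThree part) ∧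
    ∀ k k', k ≠ k' → Disjoint ((g k).leaves part) ((g k').leaves part)

/-! ### Positive definite matrices and the linear term of a determinant. -/

namespace Matrix

/-! Let `A`, `B` be the precision matrices of the first and last tree. If `det (tA + (1 - t)B)` is
invariant under `t ↦ 1 - t`, then `det A = det B` and the derivative at `1/2` vanishes. This
derivative is a multiple of `tr ((A - B) Σ_{1/2})`, which is twice the difference of the two
divergences once the determinants agree.

For the invariance, each operation gets its own parameter: `interpolation` puts the fraction `t j`
of the `j`-th moved edge at `p` and `1 - t j` at `q`. Flipping a single `t k` preserves the
determinant (`det_interpolation_update`), and flipping all of them gives the claim. Cutting the edge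
`i - p` leaves a component inside the super leaf node of `p`, untouched by the other operations
(`AreIndependent.anchors_avoid`). If it is the side of `i`, a unimodular shear completing the square
realizes the flip (`det_flip_of_source_side`); if it is the side of `p` and `q`, a reflection
exchanging these coordinates does (`det_flip_of_target_side`).

Uniqueness is strict monotonicity of `t ↦ tr ((A - B) Σ_t)`, valid as soon as `A ≠ B`. -/

theorem posDef_convexCombination {V : Type*} {A B : Matrix V V ℝ} (hA : A.PosDef) (hB : B.PosDef)
    {t : ℝ} (ht : t ∈ Set.Icc (0 : ℝ) 1) : (t • A + (1 - t) • B).PosDef := by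
  rcases ht.1.eq_or_lt with h | h
  · simpa [← h] using hB
  · exact (hA.smul h).add_posSemidef (hB.posSemidef.smul (by linarith [ht.2]))

variable {V : Type*} [Fintype V] [DecidableEq V]

open scoped MatrixOrder in
theorem PosDef.exists_isUnit_conjTranspose_mul_self {A : Matrix V V ℝ} (hA : A.PosDef) :
    ∃ C : Matrix V V ℝ, IsUnit C ∧ A = Cᴴ * C := by
  obtain ⟨C, hC, h⟩ := CStarAlgebra.isStrictlyPositive_iff_eq_star_mul_self.mp
    hA.isStrictlyPositive
  exact ⟨C, hC, h⟩

/-- With `A = Cᴴ C` and `B = Eᴴ E`, the trace is the squared Frobenius norm of `C D Eᴴ`, and `C`,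
`E` are invertible. -/
theorem PosDef.eq_zero_of_trace_mul_eq_zero {A B D : Matrix V V ℝ} (hA : A.PosDef) (hB : B.PosDef)
    (hD : D.IsHermitian) (h : (D * A * D * B).trace = 0) : D = 0 := by
  obtain ⟨C, hC, rfl⟩ := hA.exists_isUnit_conjTranspose_mul_self
  obtain ⟨E, hE, rfl⟩ := hB.exists_isUnit_conjTranspose_mul_self
  have h1 : (D * (Cᴴ * C) * D * (Eᴴ * E)).trace = ((C * D * Eᴴ)ᴴ * (C * D * Eᴴ)).trace := by
    simp only [conjTranspose_mul, conjTranspose_conjTranspose, hD.eq]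
    rw [← Matrix.mul_assoc _ Eᴴ E, trace_mul_comm]
    simp only [Matrix.mul_assoc]
  rw [h1, trace_conjTranspose_mul_self_eq_zero_iff] at h
  have hE' : IsUnit Eᴴ := (isUnit_conjTranspose E).2 hE
  rw [hE'.mul_left_eq_zero, hC.mul_right_eq_zero] at h
  exact h

/-- The linear part in `r` of `det (A + r • D)` vanishes if this function is even. -/
theorem trace_mul_inv_eq_zero_of_det_even {A D : Matrix V V ℝ} (hA : A.det ≠ 0)
    (h : ∀ r : ℝ, (A + r • D).det = (A + (-r) • D).det) : (D * A⁻¹).trace = 0 := by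
  have hu : IsUnit A.det := hA.isUnit
  set M := A⁻¹ * D with hM
  have hAM : ∀ r : ℝ, (A + r • D).det = A.det * (1 + r • M).det := by
    intro r
    rw [← det_mul, Matrix.mul_add, Matrix.mul_one, Matrix.mul_smul, hM, ← Matrix.mul_assoc,
      mul_nonsing_inv _ hu, Matrix.one_mul]
  -- `P` is the remainder in `det (1 + rM) = 1 + r tr M + r² P(r)`; comparing `r` with `-r` and
  -- letting `r → 0` isolates the trace.
  set P := (det (1 + (Polynomial.X : Polynomial ℝ) • M.map Polynomial.C)).divX.divX with hP
  have key : ∀ r : ℝ, r ≠ 0 → M.trace = - (r * (P.eval r - P.eval (-r))) / 2 := by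
    intro r hr
    have h1 := h r
    rw [hAM, hAM] at h1
    have h2 := mul_left_cancel₀ hA h1
    rw [det_one_add_smul r, det_one_add_smul (-r), ← hP] at h2
    have : r * (2 * M.trace + r * (P.eval r - P.eval (-r))) = 0 := by linarith
    rcases mul_eq_zero.1 this with h | h
    · exact absurd h hr
    · linarith
  rw [trace_mul_comm, ← hM]
  have hc : Continuous fun r : ℝ => - (r * (P.eval r - P.eval (-r))) / 2 := by
    have h1 : Continuous fun r : ℝ => P.eval r := P.continuous
    have h2 : Continuous fun r : ℝ => P.eval (-r) := P.continuous.comp continuous_neg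
    fun_prop
  have h0 : Filter.Tendsto (fun r : ℝ => - (r * (P.eval r - P.eval (-r))) / 2)
      (nhdsWithin 0 {0}ᶜ) (nhds 0) := by
    have := (hc.tendsto 0).mono_left (nhdsWithin_le_nhds (s := {0}ᶜ))
    simpa using this
  refine tendsto_nhds_unique (f := fun _ : ℝ => M.trace) tendsto_const_nhds (h0.congr' ?_)
  filter_upwards [self_mem_nhdsWithin] with r hr
  exact (key r hr).symm

end Matrix

/-! ### Optimal Chernoff parameters in terms of precision matrices. -/

section Chernoff

variable {V : Type*} [Fintype V] [DecidableEq V]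

open Matrix

/-- Equal determinants make the logarithmic terms of the two divergences coincide, so only the trace
terms remain. -/
theorem isChernoffParameter_inv_iff {A B : Matrix V V ℝ} (hA : A.PosDef) (hB : B.PosDef)
    (hdet : A.det = B.det) {t : ℝ} :
    IsChernoffParameter A⁻¹ B⁻¹ t ↔
      t ∈ Set.Icc (0 : ℝ) 1 ∧ ((A - B) * (t • A + (1 - t) • B)⁻¹).trace = 0 := by
  have h1 : A⁻¹.det = B⁻¹.det := by simp [det_nonsing_inv, hdet]
  unfold IsChernoffParameter gaussianKL tiltedCov
  rw [nonsing_inv_nonsing_inv _ hA.det_pos.ne'.isUnit,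
    nonsing_inv_nonsing_inv _ hB.det_pos.ne'.isUnit, h1, Matrix.sub_mul, trace_sub]
  refine and_congr_right fun _ => ?_
  constructor <;> intro h <;> linarith

theorem isChernoffParameter_inv_half {A B : Matrix V V ℝ} (hA : A.PosDef) (hB : B.PosDef)
    (h : ∀ t : ℝ, (t • A + (1 - t) • B).det = ((1 - t) • A + t • B).det) :
    IsChernoffParameter A⁻¹ B⁻¹ (1 / 2) := by
  have hdet : A.det = B.det := by simpa using h 1
  have ht : (1 / 2 : ℝ) ∈ Set.Icc (0 : ℝ) 1 := by norm_num
  refine (isChernoffParameter_inv_iff hA hB hdet).2 ⟨ht, ?_⟩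
  refine trace_mul_inv_eq_zero_of_det_even (posDef_convexCombination hA hB ht).det_pos.ne' ?_
  intro r
  convert h (1 / 2 + r) using 2 <;> module

/-- By the resolvent identity, subtracting the trace conditions at `s ≠ t` gives `tr (D S⁻¹ D R⁻¹) =
0` with `D = A - B`, which forces `D = 0`. -/
theorem IsChernoffParameter.inv_unique {A B : Matrix V V ℝ} (hA : A.PosDef) (hB : B.PosDef)
    (hdet : A.det = B.det) (hne : A ≠ B) {s t : ℝ} (hs : IsChernoffParameter A⁻¹ B⁻¹ s)
    (ht : IsChernoffParameter A⁻¹ B⁻¹ t) : s = t := by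
  rw [isChernoffParameter_inv_iff hA hB hdet] at hs ht
  by_contra hst
  have hS := posDef_convexCombination hA hB hs.1
  have hT := posDef_convexCombination hA hB ht.1
  set S := s • A + (1 - s) • B with hSdef
  set R := t • A + (1 - t) • B with hRdef
  have hsub : S - R = (s - t) • (A - B) := by rw [hSdef, hRdef]; module
  have hres : R⁻¹ - S⁻¹ = (s - t) • (S⁻¹ * (A - B) * R⁻¹) := by
    have h1 : S⁻¹ * (S - R) * R⁻¹ = R⁻¹ - S⁻¹ := by
      rw [Matrix.mul_sub, Matrix.sub_mul, nonsing_inv_mul _ hS.det_pos.ne'.isUnit, Matrix.one_mul,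
        Matrix.mul_assoc, mul_nonsing_inv _ hT.det_pos.ne'.isUnit, Matrix.mul_one]
    rw [← h1, hsub]
    simp
  have htr : ((A - B) * S⁻¹ * (A - B) * R⁻¹).trace = 0 := by
    have h2 : ((A - B) * (R⁻¹ - S⁻¹)).trace = 0 := by
      rw [Matrix.mul_sub, trace_sub, hs.2, ht.2, sub_zero]
    rw [hres, Matrix.mul_smul, trace_smul, smul_eq_mul] at h2
    rcases mul_eq_zero.1 h2 with h | h
    · exact absurd (sub_eq_zero.1 h) hst
    · simpa only [Matrix.mul_assoc] using h
  exact hne (sub_eq_zero.1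
    (hS.inv.eq_zero_of_trace_mul_eq_zero hT.inv (hA.isHermitian.sub hB.isHermitian) htr))

end Chernoff

/-! ### Edge contributions and the two determinant flips. -/

section EdgeTerm

variable {V : Type*} [DecidableEq V]

open Matrix

/-- The contribution of an edge `a - b` with weight `w` to the precision matrix of a Gaussian
tree. -/
noncomputable def edgeTerm (a b : V) (w : ℝ) : Matrix V V ℝ :=
  Matrix.of fun x y =>
    w ^ 2 / (1 - w ^ 2) * ((Pi.single a 1 : V → ℝ) x * (Pi.single a 1 : V → ℝ) y +
        (Pi.single b 1 : V → ℝ) x * (Pi.single b 1 : V → ℝ) y) -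
      w / (1 - w ^ 2) * ((Pi.single a 1 : V → ℝ) x * (Pi.single b 1 : V → ℝ) y +
        (Pi.single b 1 : V → ℝ) x * (Pi.single a 1 : V → ℝ) y)

theorem edgeTerm_transpose (a b : V) (w : ℝ) : (edgeTerm a b w)ᵀ = edgeTerm a b w := by
  ext x y
  simp only [edgeTerm, transpose_apply, of_apply]
  ring

variable [Fintype V]

theorem edgeTerm_mulVec (a b : V) (w : ℝ) (u : V → ℝ) (x : V) :
    (edgeTerm a b w *ᵥ u) x =
      w ^ 2 / (1 - w ^ 2) * ((Pi.single a 1 : V → ℝ) x * u a + (Pi.single b 1 : V → ℝ) x * u b) -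
      w / (1 - w ^ 2) * ((Pi.single a 1 : V → ℝ) x * u b + (Pi.single b 1 : V → ℝ) x * u a) := by
  have h : ∀ c : V, ∑ y, (Pi.single c 1 : V → ℝ) y * u y = u c := by
    intro c; simp [Pi.single_apply]
  rw [← h a, ← h b]
  simp only [mulVec, dotProduct, edgeTerm, of_apply, Finset.mul_sum, ← Finset.sum_add_distrib,
    ← Finset.sum_sub_distrib]
  exact Finset.sum_congr rfl fun y _ => by ring

theorem edgeTerm_mulVec_eq_zero {a b : V} {w : ℝ} {u : V → ℝ} (ha : u a = 0) (hb : u b = 0) :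
    edgeTerm a b w *ᵥ u = 0 := by
  ext x
  simp [edgeTerm_mulVec, ha, hb]

/-- Congruence by a rank one perturbation of the identity. -/
theorem det_eq_of_rank_one_congruence {N N' : Matrix V V ℝ} (hN : Nᵀ = N) (a d : V → ℝ) (c : ℝ)
    (hc : (1 + c * (d ⬝ᵥ a)) ^ 2 = 1)
    (h : ∀ x y, N' x y = N x y + c * (d x * (N *ᵥ a) y + (N *ᵥ a) x * d y) +
      c ^ 2 * (a ⬝ᵥ (N *ᵥ a)) * (d x * d y)) :
    N'.det = N.det := by
  -- The hypothesis `h` is the expansion of `N' = Mᵀ N M`, and `hc` says that `det M = ±1`.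
  set M : Matrix V V ℝ := 1 + vecMulVec (c • a) d with hM
  have hdet : M.det = 1 + c * (d ⬝ᵥ a) := by
    have := det_one_add_replicateCol_mul_replicateRow (ι := Unit) (c • a) d
    rw [← vecMulVec_eq] at this
    rw [hM, this, dotProduct_smul, smul_eq_mul]
  have hvN : a ᵥ* N = N *ᵥ a := by
    conv_lhs => rw [← hN]
    rw [vecMul_transpose]
  have hMNM : Mᵀ * N * M = N' := by
    rw [hM, transpose_add, transpose_one, transpose_vecMulVec, Matrix.add_mul, Matrix.add_mul,
      Matrix.one_mul, Matrix.mul_add, Matrix.mul_add, Matrix.mul_one, Matrix.mul_one,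
      vecMulVec_mul, mul_vecMulVec, vecMulVec_mul_vecMulVec]
    ext x y
    simp only [Matrix.add_apply, vecMulVec_apply, h, smul_vecMul, hvN, mulVec_smul,
      Pi.smul_apply, smul_eq_mul, smul_dotProduct, dotProduct_smul, dotProduct_comm (N *ᵥ a) a]
    ring
  rw [← hMNM, det_mul, det_mul, det_transpose, hdet]
  linear_combination N.det * hc

/-- If the side of `i` is an unperturbed tree, it can be integrated out. -/
theorem det_flip_of_source_side {N : Matrix V V ℝ} (hN : Nᵀ = N) {i p q : V} {w : ℝ}
    (hw : 1 - w ^ 2 ≠ 0) {a : V → ℝ} (ha : N *ᵥ a = Pi.single i 1) (hai : a i = 1)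
    (hap : a p = 0) (haq : a q = 0) (t : ℝ) :
    (N + t • edgeTerm i p w + (1 - t) • edgeTerm i q w).det =
      (N + (1 - t) • edgeTerm i p w + t • edgeTerm i q w).det := by
  set d : V → ℝ := Pi.single p 1 - Pi.single q 1 with hd
  have hN' : (N + (1 - t) • edgeTerm i p w + t • edgeTerm i q w)ᵀ =
      N + (1 - t) • edgeTerm i p w + t • edgeTerm i q w := by
    simp [edgeTerm_transpose, hN]
  have hda : d ⬝ᵥ a = 0 := by simp [hd, hap, haq, sub_dotProduct]
  have hmul : ∀ x, ((N + (1 - t) • edgeTerm i p w + t • edgeTerm i q w) *ᵥ a) x =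
      1 / (1 - w ^ 2) * (Pi.single i 1 : V → ℝ) x - w / (1 - w ^ 2) *
        ((1 - t) * (Pi.single p 1 : V → ℝ) x + t * (Pi.single q 1 : V → ℝ) x) := by
    intro x
    simp only [add_mulVec, smul_mulVec, Pi.add_apply, Pi.smul_apply, ha, edgeTerm_mulVec, hai,
      hap, haq, smul_eq_mul]
    field_simp
    ring
  have hquad : a ⬝ᵥ ((N + (1 - t) • edgeTerm i p w + t • edgeTerm i q w) *ᵥ a) =
      1 / (1 - w ^ 2) := by
    have : (N + (1 - t) • edgeTerm i p w + t • edgeTerm i q w) *ᵥ a =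
      (1 / (1 - w ^ 2)) • (Pi.single i 1 : V → ℝ) - (w / (1 - w ^ 2)) •
        ((1 - t) • (Pi.single p 1 : V → ℝ) + t • (Pi.single q 1 : V → ℝ)) := by
      ext x
      rw [hmul]
      simp [mul_add]
    rw [this]
    simp [dotProduct_sub, dotProduct_add, dotProduct_smul, hai, hap, haq]
  -- In the completed square, `x_i` is centred at `w` times the weighted mean of `x_p` and `x_q`;
  -- the flip moves this centre by `w (1 - 2t) (x_p - x_q)`. The leftover `w² t (1 - t) (x_p - x_q)²
  -- / (1 - w²)` is already symmetric.
  refine det_eq_of_rank_one_congruence hN' a d (w * (1 - 2 * t)) (by simp [hda]) ?_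
  intro x y
  rw [hmul, hmul, hquad]
  simp only [Matrix.add_apply, Matrix.smul_apply, smul_eq_mul, edgeTerm, of_apply, hd, Pi.sub_apply]
  field_simp
  ring

/-- If the side of `p` and `q` is an unperturbed tree, `p` and `q` are exchanged by a reflection. -/
theorem det_flip_of_target_side {N : Matrix V V ℝ} (hN : Nᵀ = N) {i p q : V} {w : ℝ}
    (hw : 1 - w ^ 2 ≠ 0) {u : V → ℝ} (hu : N *ᵥ u = Pi.single p 1 - Pi.single q 1) (hui : u i = 0)
    (hup : u p ≠ 0) (huq : u q = - u p) (t : ℝ) :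
    (N + t • edgeTerm i p w + (1 - t) • edgeTerm i q w).det =
      (N + (1 - t) • edgeTerm i p w + t • edgeTerm i q w).det := by
  set d : V → ℝ := Pi.single p 1 - Pi.single q 1 with hd
  have hN' : (N + (1 - t) • edgeTerm i p w + t • edgeTerm i q w)ᵀ =
      N + (1 - t) • edgeTerm i p w + t • edgeTerm i q w := by
    simp [edgeTerm_transpose, hN]
  have hdu : d ⬝ᵥ u = 2 * u p := by
    simp [hd, huq, sub_dotProduct]; ring
  have hmul' : (N + (1 - t) • edgeTerm i p w + t • edgeTerm i q w) *ᵥ u =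
      d + (u p * w ^ 2 / (1 - w ^ 2)) • ((1 - t) • (Pi.single p 1 : V → ℝ) -
        t • (Pi.single q 1 : V → ℝ)) -
        (u p * w / (1 - w ^ 2) * (1 - 2 * t)) • (Pi.single i 1 : V → ℝ) := by
    ext x
    simp only [add_mulVec, smul_mulVec, Pi.add_apply, Pi.smul_apply, hu, edgeTerm_mulVec, hui,
      huq, smul_eq_mul, Pi.sub_apply]
    ring
  have hquad : u ⬝ᵥ ((N + (1 - t) • edgeTerm i p w + t • edgeTerm i q w) *ᵥ u) =
      2 * u p + u p ^ 2 * w ^ 2 / (1 - w ^ 2) := by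
    rw [hmul', dotProduct_sub, dotProduct_add, dotProduct_comm u d, hdu]
    simp [dotProduct_sub, dotProduct_smul, hui, huq]
    ring
  -- Since `N u = d` and `d ⬝ᵥ u = 2 u_p`, the map `x ↦ x - (d ⬝ᵥ x / u_p) u` is an `N`-orthogonal
  -- reflection of determinant `-1`. It swaps `x_p` and `x_q` and fixes `x_i`.
  refine det_eq_of_rank_one_congruence hN' u d (-(u p)⁻¹) (by rw [hdu]; field_simp; norm_num) ?_
  intro x y
  rw [hquad, hmul']
  simp only [Matrix.add_apply, Matrix.smul_apply, smul_eq_mul, edgeTerm, of_apply, hd, Pi.sub_apply,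
    Pi.add_apply, Pi.smul_apply]
  field_simp
  ring

end EdgeTerm

/-! ### Precision matrices built edge by edge. -/

section Precision

open Matrix

variable {V : Type*} [Fintype V] [DecidableEq V]

/-- The precision matrix of a Gaussian tree with the edge weights `W`, where `W` vanishes off the
edge set. -/
noncomputable def precision (W : Sym2 V → ℝ) : Matrix V V ℝ :=
  Matrix.of fun x y =>
    (if x = y then 1 + ∑ z, W s(x, z) ^ 2 / (1 - W s(x, z) ^ 2) else 0) -
      W s(x, y) / (1 - W s(x, y) ^ 2)

theorem precision_transpose (W : Sym2 V → ℝ) : (precision W)ᵀ = precision W := by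
  ext x y
  by_cases h : x = y
  · rw [h]; rfl
  · simp [precision, h, Ne.symm h, Sym2.eq_swap (a := y) (b := x)]

theorem precision_mulVec (W : Sym2 V → ℝ) (c : V → ℝ) (x : V) :
    (precision W *ᵥ c) x = c x + ∑ z, (W s(x, z) ^ 2 / (1 - W s(x, z) ^ 2) * c x -
      W s(x, z) / (1 - W s(x, z) ^ 2) * c z) := by
  simp only [mulVec, dotProduct, precision, of_apply, sub_mul, Finset.sum_sub_distrib, ite_mul,
    zero_mul, Finset.sum_ite_eq, Finset.mem_univ, if_true, add_mul, one_mul, Finset.sum_mul]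
  ring

theorem precision_zero : precision (0 : Sym2 V → ℝ) = 1 := by
  ext x y
  simp [precision, one_apply]

theorem precision_eq_add_edgeTerm {W W' : Sym2 V → ℝ} {a b : V} (hab : a ≠ b)
    (h0 : W s(a, b) = 0) (h : ∀ e, e ≠ s(a, b) → W' e = W e) :
    precision W' = precision W + edgeTerm a b (W' s(a, b)) := by
  -- Applied below to both `w² / (1 - w²)` and `w / (1 - w²)`.
  have key : ∀ (f : ℝ → ℝ), f 0 = 0 → ∀ x z, f (W' s(x, z)) = f (W s(x, z)) +
      ((Pi.single a 1 : V → ℝ) x * (Pi.single b 1 : V → ℝ) z +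
        (Pi.single b 1 : V → ℝ) x * (Pi.single a 1 : V → ℝ) z) * f (W' s(a, b)) := by
    intro f hf x z
    by_cases hxz : s(x, z) = s(a, b)
    · rw [hxz, h0, hf]
      rcases Sym2.eq_iff.1 hxz with ⟨rfl, rfl⟩ | ⟨rfl, rfl⟩ <;> simp [hab, hab.symm]
    · rw [h _ hxz]
      have h1 : ¬ (x = a ∧ z = b) := fun hh => hxz (by rw [hh.1, hh.2])
      have h2 : ¬ (x = b ∧ z = a) := fun hh => hxz (by rw [hh.1, hh.2, Sym2.eq_swap])
      have h3 : (Pi.single a 1 : V → ℝ) x * (Pi.single b 1 : V → ℝ) z = 0 := by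
        simp only [Pi.single_apply]; grind
      have h4 : (Pi.single b 1 : V → ℝ) x * (Pi.single a 1 : V → ℝ) z = 0 := by
        simp only [Pi.single_apply]; grind
      rw [h3, h4]
      ring
  ext x y
  have k1 := key (fun w => w ^ 2 / (1 - w ^ 2)) (by norm_num) x
  have k2 := key (fun w => w / (1 - w ^ 2)) (by norm_num) x y
  beta_reduce at k1 k2
  have hs : ∑ z, W' s(x, z) ^ 2 / (1 - W' s(x, z) ^ 2) =
      ∑ z, W s(x, z) ^ 2 / (1 - W s(x, z) ^ 2) +
        ((Pi.single a 1 : V → ℝ) x + (Pi.single b 1 : V → ℝ) x) *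
          (W' s(a, b) ^ 2 / (1 - W' s(a, b) ^ 2)) := by
    rw [Finset.sum_congr rfl fun z _ => k1 z, Finset.sum_add_distrib, ← Finset.sum_mul,
      Finset.sum_add_distrib, ← Finset.mul_sum, ← Finset.mul_sum]
    simp
  simp only [precision, edgeTerm, of_apply, Matrix.add_apply, hs, k2]
  by_cases hxy : x = y
  · subst hxy
    have i1 : ∀ c : V, (Pi.single c 1 : V → ℝ) x * (Pi.single c 1 : V → ℝ) x =
        (Pi.single c 1 : V → ℝ) x := by
      intro c; simp only [Pi.single_apply]; split_ifs <;> simp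
    simp only [if_true, i1]
    ring
  · have i1 : ∀ c : V, (Pi.single c 1 : V → ℝ) x * (Pi.single c 1 : V → ℝ) y = 0 := by
      intro c; simp only [Pi.single_apply]; grind
    simp only [hxy, if_false, i1]
    ring

/-- Adding an edge between two uncorrelated nodes of unit variance preserves positive
definiteness. -/
theorem posDef_add_edgeTerm {K S : Matrix V V ℝ} (hK : K.PosDef) (hKS : K * S = 1) {a b : V}
    (ha : S a a = 1) (hb : S b b = 1) (hab : S a b = 0) {w : ℝ} (hw : |w| < 1) :
    (K + edgeTerm a b w).PosDef := by
  have hw2 : 0 < 1 - w ^ 2 := by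
    have := (sq_lt_one_iff_abs_lt_one w).2 hw
    linarith
  have hKt : Kᵀ = K := by simpa using hK.isHermitian.eq
  have hcol : ∀ c, K *ᵥ (fun v => S v c) = Pi.single c 1 := by
    intro c
    ext x
    have := congrFun (congrFun hKS x) c
    rw [one_apply, mul_apply] at this
    rw [Pi.single_apply]
    exact this
  refine .of_dotProduct_mulVec_pos ?_ ?_
  · refine hK.isHermitian.add ?_
    simpa [IsHermitian] using edgeTerm_transpose a b w
  intro x hx
  set sa : V → ℝ := fun v => S v a with hsa
  set sb : V → ℝ := fun v => S v b with hsb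
  have hsym : ∀ u v : V → ℝ, u ⬝ᵥ (K *ᵥ v) = v ⬝ᵥ (K *ᵥ u) := by
    intro u v
    rw [dotProduct_mulVec, ← mulVec_transpose, hKt, dotProduct_comm]
  have hxa : x ⬝ᵥ (K *ᵥ sa) = x a := by rw [hcol a]; simp
  have hxb : x ⬝ᵥ (K *ᵥ sb) = x b := by rw [hcol b]; simp
  have haa : sa ⬝ᵥ (K *ᵥ sa) = 1 := by rw [hcol a]; simp [hsa, ha]
  have hbb : sb ⬝ᵥ (K *ᵥ sb) = 1 := by rw [hcol b]; simp [hsb, hb]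
  have hba : sb ⬝ᵥ (K *ᵥ sa) = 0 := by rw [hcol a]; simp [hsb, hab]
  have hab' : sa ⬝ᵥ (K *ᵥ sb) = 0 := by rw [hsym, hba]
  -- Bessel's inequality: the columns `sa`, `sb` of `S` are orthonormal for `K`, and the
  -- coefficients of `x` along them are `x a` and `x b`.
  have hbessel : x a ^ 2 + x b ^ 2 ≤ x ⬝ᵥ (K *ᵥ x) := by
    have := hK.posSemidef.dotProduct_mulVec_nonneg (x - x a • sa - x b • sb)
    simp only [star_trivial, mulVec_sub, mulVec_smul, dotProduct_sub, sub_dotProduct,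
      dotProduct_smul, smul_dotProduct, smul_eq_mul, hxa, hxb, haa, hbb, hba, hab', hsym sa x,
      hsym sb x] at this
    nlinarith
  have hpos := hK.dotProduct_mulVec_pos hx
  simp only [star_trivial] at hpos ⊢
  have hedge : x ⬝ᵥ (edgeTerm a b w *ᵥ x) =
      (x a ^ 2 - 2 * w * x a * x b + x b ^ 2) / (1 - w ^ 2) - x a ^ 2 - x b ^ 2 := by
    have : edgeTerm a b w *ᵥ x =
        (w ^ 2 / (1 - w ^ 2) * x a - w / (1 - w ^ 2) * x b) • (Pi.single a 1 : V → ℝ) +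
        (w ^ 2 / (1 - w ^ 2) * x b - w / (1 - w ^ 2) * x a) • (Pi.single b 1 : V → ℝ) := by
      ext v
      rw [edgeTerm_mulVec]
      simp only [Pi.add_apply, Pi.smul_apply, smul_eq_mul]
      ring
    rw [this, dotProduct_add, dotProduct_smul, dotProduct_smul]
    simp only [dotProduct_single, smul_eq_mul, mul_one]
    field_simp
    ring
  rw [add_mulVec, dotProduct_add, hedge]
  have hq : (1 - w ^ 2) * x b ^ 2 ≤ x a ^ 2 - 2 * w * x a * x b + x b ^ 2 := by
    nlinarith [sq_nonneg (x a - w * x b)]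
  have hq' : (1 - w ^ 2) * x a ^ 2 ≤ x a ^ 2 - 2 * w * x a * x b + x b ^ 2 := by
    nlinarith [sq_nonneg (x b - w * x a)]
  have h1 : x b ^ 2 ≤ (x a ^ 2 - 2 * w * x a * x b + x b ^ 2) / (1 - w ^ 2) := by
    rw [le_div_iff₀ hw2]; linarith
  have h2 : x a ^ 2 ≤ (x a ^ 2 - 2 * w * x a * x b + x b ^ 2) / (1 - w ^ 2) := by
    rw [le_div_iff₀ hw2]; linarith
  nlinarith [sq_nonneg (x a), sq_nonneg (x b)]

end Precision

/-! ### Covariance and precision of a Gaussian tree. -/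

namespace GaussianTree

variable {V : Type*} (T : GaussianTree V)

theorem path_isPath (i j : V) : (T.path i j).IsPath :=
  (T.isTree.existsUnique_path i j).choose_spec.1

theorem eq_path {i j : V} {P : T.graph.Walk i j} (hP : P.IsPath) : P = T.path i j :=
  (T.isTree.existsUnique_path i j).choose_spec.2 P hP

theorem cov_eq_of_isPath {i j : V} {P : T.graph.Walk i j} (hP : P.IsPath) :
    T.cov i j = (P.edges.map T.weight).prod := by
  rw [T.eq_path hP]
  rfl

theorem cov_self (i : V) : T.cov i i = 1 := by
  rw [T.cov_eq_of_isPath SimpleGraph.Walk.IsPath.nil]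
  simp

theorem cov_comm (i j : V) : T.cov i j = T.cov j i := by
  rw [T.cov_eq_of_isPath (T.path_isPath j i).reverse, SimpleGraph.Walk.edges_reverse,
    List.map_reverse, List.prod_reverse]
  rfl

theorem cov_eq_weight {i j : V} (h : T.graph.Adj i j) : T.cov i j = T.weight s(i, j) := by
  have hP : (SimpleGraph.Walk.cons h SimpleGraph.Walk.nil).IsPath := by
    simp [SimpleGraph.Walk.cons_isPath_iff, h.ne]
  rw [T.cov_eq_of_isPath hP]
  simp

/-- The neighbour of `x` on the path to `y`. -/
theorem exists_next {x y : V} (hxy : x ≠ y) :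
    ∃ z, T.graph.Adj x z ∧ T.cov x y = T.weight s(x, z) * T.cov z y ∧
      ∀ z', T.graph.Adj x z' → z' ≠ z → T.cov z' y = T.weight s(x, z') * T.cov x y := by
  classical
  have hnil : ¬ (T.path x y).Nil := SimpleGraph.Walk.not_nil_of_ne hxy
  have hadj := (T.path x y).adj_snd hnil
  refine ⟨(T.path x y).snd, hadj, ?_, ?_⟩
  · have hcons := (T.path x y).cons_tail_eq hnil
    have htail : (T.path x y).tail.IsPath := (T.path_isPath x y).tail
    rw [T.cov_eq_of_isPath htail, T.cov_eq_of_isPath (T.path_isPath x y)]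
    conv_lhs => rw [← hcons]
    simp
  · intro z' hz' hne
    -- A neighbour of `x` on the path must be its second vertex, as paths in a tree are unique; any
    -- other neighbour extends the path backwards.
    have hns : z' ∉ (T.path x y).support := by
      intro hmem
      apply hne
      have h1 := ((T.path_isPath x y).takeUntil hmem)
      have hP : (SimpleGraph.Walk.cons hz' SimpleGraph.Walk.nil).IsPath := by
        simp [SimpleGraph.Walk.cons_isPath_iff, hz'.ne]
      have h2 := (T.eq_path h1).trans (T.eq_path hP).symm
      have h3 := (T.path x y).snd_takeUntil hz'.ne' hmem
      rw [h2] at h3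
      simpa using h3
    have hP : (SimpleGraph.Walk.cons hz'.symm (T.path x y)).IsPath :=
      SimpleGraph.Walk.cons_isPath_iff _ _ |>.2 ⟨T.path_isPath x y, hns⟩
    rw [T.cov_eq_of_isPath hP, T.cov_eq_of_isPath (T.path_isPath x y)]
    simp [Sym2.eq_swap]

/-- The edge weights, extended by zero. -/
noncomputable def edgeWeight : Sym2 V → ℝ := T.graph.edgeSet.indicator T.weight

theorem edgeWeight_of_adj {x y : V} (h : T.graph.Adj x y) :
    T.edgeWeight s(x, y) = T.weight s(x, y) :=
  Set.indicator_of_mem (by simpa using h) _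

theorem edgeWeight_of_not_adj {x y : V} (h : ¬ T.graph.Adj x y) : T.edgeWeight s(x, y) = 0 :=
  Set.indicator_of_notMem (by simpa using h) _

theorem abs_edgeWeight_lt_one (e : Sym2 V) : |T.edgeWeight e| < 1 := by
  by_cases h : e ∈ T.graph.edgeSet
  · simpa [edgeWeight, h] using T.abs_weight_lt_one e h
  · simp [edgeWeight, h]

theorem one_sub_sq_edgeWeight_pos (e : Sym2 V) : 0 < 1 - T.edgeWeight e ^ 2 := by
  have := (sq_lt_one_iff_abs_lt_one _).2 (T.abs_edgeWeight_lt_one e)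
  linarith

/-- The Gaussian tree in which the weights outside `X` are set to zero. -/
noncomputable def restrict (X : Set (Sym2 V)) : GaussianTree V where
  graph := T.graph
  isTree := T.isTree
  weight := X.indicator T.weight
  abs_weight_lt_one e he := by
    by_cases h : e ∈ X
    · simpa [h] using T.abs_weight_lt_one e he
    · simp [h]

theorem edgeWeight_restrict (X : Set (Sym2 V)) :
    (T.restrict X).edgeWeight = X.indicator T.edgeWeight := by
  simp only [edgeWeight, restrict, Set.indicator_indicator, Set.inter_comm]

/-- The path from `x` to `y` must use the cut edge, whose weight is now zero. -/
theorem cov_restrict_eq_zero {x y i p : V}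
    (h : ¬ (T.graph.deleteEdges {s(i, p)}).Reachable x y) :
    (T.restrict {s(i, p)}ᶜ).cov x y = 0 := by
  have hmem : s(i, p) ∈ ((T.restrict {s(i, p)}ᶜ).path x y).edges := by
    by_contra hn
    exact h ⟨SimpleGraph.Walk.toDeleteEdge (G := T.graph) _ _ hn⟩
  refine List.prod_eq_zero (List.mem_map.2 ⟨_, hmem, ?_⟩)
  simp [restrict]

section

open Matrix

variable [Fintype V] [DecidableEq V]

theorem precision_mul_cov : precision T.edgeWeight * T.cov = 1 := by
  ext x y
  have hcol : (precision T.edgeWeight * T.cov) x y =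
      (precision T.edgeWeight *ᵥ fun v => T.cov v y) x := rfl
  rw [hcol, precision_mulVec, one_apply]
  have hterm : ∀ z, (T.graph.Adj x z → T.cov z y = T.weight s(x, z) * T.cov x y) →
      T.edgeWeight s(x, z) ^ 2 / (1 - T.edgeWeight s(x, z) ^ 2) * T.cov x y -
        T.edgeWeight s(x, z) / (1 - T.edgeWeight s(x, z) ^ 2) * T.cov z y = 0 := by
    intro z hz
    by_cases h : T.graph.Adj x z
    · rw [hz h, T.edgeWeight_of_adj h]
      ring
    · simp [T.edgeWeight_of_not_adj h]
  by_cases hxy : x = y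
  · subst hxy
    rw [Finset.sum_eq_zero, if_pos rfl, T.cov_self, add_zero]
    intro z _
    refine hterm z fun h => ?_
    rw [T.cov_self, mul_one, T.cov_comm, T.cov_eq_weight h]
  · obtain ⟨z, hz, hz1, hz2⟩ := T.exists_next hxy
    -- Only the neighbour towards `y` contributes, and its term cancels `T.cov x y`.
    rw [if_neg hxy, Finset.sum_eq_single z (fun z' _ hne => hterm z' fun h => hz2 z' h hne)
      (by simp)]
    have hpos := (T.one_sub_sq_edgeWeight_pos s(x, z)).ne'
    rw [T.edgeWeight_of_adj hz] at hpos ⊢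
    rw [hz1]
    field_simp
    ring

/-- Edge weights are switched on one at a time. Before its turn an edge has weight zero, so its
endpoints are uncorrelated and `posDef_add_edgeTerm` applies. -/
theorem posDef_precision : (precision T.edgeWeight).PosDef := by
  have key : ∀ X : Finset (Sym2 V), (precision (T.restrict (X : Set (Sym2 V))).edgeWeight).PosDef := by
    intro X
    induction X using Finset.induction_on with
    | empty =>
      have : (T.restrict ((∅ : Finset (Sym2 V)) : Set (Sym2 V))).edgeWeight = 0 := by
        rw [edgeWeight_restrict, Finset.coe_empty, Set.indicator_empty']
      rw [this, precision_zero]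
      exact PosDef.one
    | insert e X he ih =>
      induction e using Sym2.ind with
      | _ a b =>
      by_cases hab : T.graph.Adj a b
      · have h1 := precision_eq_add_edgeTerm (W := (T.restrict (X : Set (Sym2 V))).edgeWeight)
          (W' := (T.restrict ((insert s(a, b) X : Finset (Sym2 V)) : Set (Sym2 V))).edgeWeight)
          hab.ne (by simp [edgeWeight_restrict, he]) (by
            intro e' he'
            simp [edgeWeight_restrict, Set.indicator_apply, he'])
        rw [h1]
        refine posDef_add_edgeTerm ih (precision_mul_cov _) (cov_self _ _) (cov_self _ _) ?_
          (abs_edgeWeight_lt_one _ _)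
        rw [cov_eq_weight _ (show (T.restrict (X : Set (Sym2 V))).graph.Adj a b from hab)]
        simp [restrict, he]
      · have : (T.restrict ((insert s(a, b) X : Finset (Sym2 V)) : Set (Sym2 V))).edgeWeight =
            (T.restrict (X : Set (Sym2 V))).edgeWeight := by
          ext e'
          by_cases he' : e' = s(a, b)
          · subst he'
            simp [edgeWeight_restrict, T.edgeWeight_of_not_adj hab, he]
          · simp [edgeWeight_restrict, Set.indicator_apply, he']
        rw [this]
        exact ih
  have := key Finset.univ
  rwa [edgeWeight_restrict, Finset.coe_univ, Set.indicator_univ] at this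

theorem cov_eq_inv_precision : T.cov = (precision T.edgeWeight)⁻¹ :=
  (inv_eq_right_inv T.precision_mul_cov).symm

/-- The difference of the two variables has variance `2 - 2 T.cov x y > 0`. This makes the
reflection above well defined. -/
theorem cov_lt_one {x y : V} (h : x ≠ y) : T.cov x y < 1 := by
  have hpos : T.cov.PosDef := by
    rw [cov_eq_inv_precision]
    exact T.posDef_precision.inv
  have hne : (Pi.single x 1 - Pi.single y 1 : V → ℝ) ≠ 0 := by
    intro h0
    have := congrFun h0 x
    simp [h] at this
  have := hpos.dotProduct_mulVec_pos hne
  simp only [star_trivial, mulVec_sub, dotProduct_sub, sub_dotProduct, mulVec_single_one,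
    single_dotProduct, col_apply, one_mul, cov_self, T.cov_comm y x] at this
  linarith

end

end GaussianTree

/-! ### Star-shaped trees and the components left by a cut. -/

section Combinatorics

open SimpleGraph

variable {V : Type*}

/-- A vertex set that is left by no edge contains the connected components of its elements. -/
theorem SimpleGraph.Reachable.mem_of_forall_adj {G : SimpleGraph V} {S : Set V} {x y : V}
    (h : G.Reachable x y) (hS : ∀ u ∈ S, ∀ v, G.Adj u v → v ∈ S) (hx : x ∈ S) : y ∈ S := by
  obtain ⟨P⟩ := h
  induction P with
  | nil => exact hx
  | cons hadj _ ih => exact ih (hS _ hx _ hadj)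

theorem SimpleGraph.Connected.reachable_deleteEdges_of_induce {G : SimpleGraph V} {S : Set V}
    (h : (G.induce S).Connected) {x y a b : V} (hx : x ∈ S) (hy : y ∈ S) (hb : b ∉ S) :
    (G.deleteEdges {s(a, b)}).Reachable x y := by
  have h1 := h.preconnected ⟨x, hx⟩ ⟨y, hy⟩
  refine h1.map (G' := G.deleteEdges {s(a, b)}) ⟨Subtype.val, ?_⟩
  intro u v huv
  rw [deleteEdges_adj]
  refine ⟨huv, fun he => hb ?_⟩
  have : b ∈ s(u.1, v.1) := by rw [Set.mem_singleton_iff.1 he]; simp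
  rcases Sym2.mem_iff.1 this with rfl | rfl
  exacts [u.2, v.2]

variable {m : ℕ} {part : V → Option (Fin m)}

/-- In a star-shaped tree a super leaf node is joined to the center by at most one edge. -/
theorem IsStarShaped.boundary_unique {G : SimpleGraph V} (hG : G.IsTree)
    (hs : IsStarShaped G part) {l : Fin m} {x x' z z' : V} (hx : part x = some l)
    (hx' : part x' = some l) (hz : part z ≠ some l) (hz' : part z' ≠ some l)
    (hxz : G.Adj x z) (hxz' : G.Adj x' z') : x = x' ∧ z = z' := by
  have hnone : ∀ {u v : V}, part u = some l → part v ≠ some l → G.Adj u v → part v = none := by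
    intro u v hu hv huv
    rcases hpv : part v with _ | l'
    · rfl
    · exact absurd (by rw [hpv, hs.leaf_separate u v l l' hu hpv huv]) hv
  -- A second boundary edge would close a cycle through the connected leaf and the connected center,
  -- although `x - z` is a bridge.
  by_contra hne
  have hbr := isAcyclic_iff_forall_adj_isBridge.1 hG.isAcyclic hxz
  rw [isBridge_iff] at hbr
  apply hbr
  have h1 : (G.deleteEdges {s(x, z)}).Reachable x x' :=
    (hs.leaf_connected l).reachable_deleteEdges_of_induce hx hx' hz
  have h2 : (G.deleteEdges {s(x, z)}).Reachable z' z := by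
    rw [Sym2.eq_swap]
    exact hs.center_connected.reachable_deleteEdges_of_induce (hnone hx' hz' hxz')
      (hnone hx hz hxz) (by simp [hx])
  have h3 : (G.deleteEdges {s(x, z)}).Adj x' z' := by
    rw [deleteEdges_adj]
    refine ⟨hxz', fun he => ?_⟩
    rcases Sym2.eq_iff.1 (Set.mem_singleton_iff.1 he) with ⟨h, h'⟩ | ⟨h, h'⟩
    · exact hne ⟨h.symm, h'.symm⟩
    · exact hz (h ▸ hx')
  exact h1.trans (h3.reachable.trans h2)

variable {T T' : GaussianTree V} {g : Graft V}

theorem IsGraft.not_reachable (h : IsGraft T T' g) :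
    ¬ (T.graph.deleteEdges {s(g.i, g.p)}).Reachable g.i g.p :=
  isBridge_iff.1 (isAcyclic_iff_forall_adj_isBridge.1 T.isTree.isAcyclic h.adj)

/-- Otherwise the component of `p` after the cut would not be joined to `i` by the new edge, and
`T'` would be disconnected. -/
theorem IsGraft.reachable (h : IsGraft T T' g) :
    (T.graph.deleteEdges {s(g.i, g.p)}).Reachable g.p g.q := by
  by_contra hq
  have hreach : T'.graph.Reachable g.p g.i := T'.isTree.connected.preconnected _ _
  refine h.not_reachable (Reachable.symm ?_)
  refine hreach.mem_of_forall_adj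
    (S := {v | (T.graph.deleteEdges {s(g.i, g.p)}).Reachable g.p v}) ?_ (Reachable.refl _)
  intro u hu v huv
  rw [h.graph_eq, sup_adj] at huv
  rcases huv with huv | huv
  · exact Reachable.trans hu huv.reachable
  · rw [edge_adj] at huv
    rcases huv.1 with ⟨rfl, rfl⟩ | ⟨rfl, rfl⟩
    · exact absurd (Reachable.symm hu) h.not_reachable
    · exact absurd hu hq

theorem IsGraft.source_ne_target (h : IsGraft T T' g) : g.i ≠ g.q := fun he =>
  h.not_reachable (he ▸ h.reachable.symm)

theorem IsGraft.not_adj (h : IsGraft T T' g) : ¬ T.graph.Adj g.i g.q := by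
  intro hadj
  refine h.not_reachable (Reachable.trans (Adj.reachable ?_) h.reachable.symm)
  rw [deleteEdges_adj]
  refine ⟨hadj, fun he => ?_⟩
  rcases Sym2.eq_iff.1 (Set.mem_singleton_iff.1 he) with ⟨-, h'⟩ | ⟨h', -⟩
  · exact h.ne h'.symm
  · exact h.adj.ne h'

theorem IsGraft.adj_iff (h : IsGraft T T' g) {u v : V} (hi : u ≠ g.i) (hp : u ≠ g.p)
    (hq : u ≠ g.q) : T'.graph.Adj u v ↔ T.graph.Adj u v := by
  rw [h.graph_eq, sup_adj, deleteEdges_adj, edge_adj, Set.mem_singleton_iff, Sym2.eq_iff]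
  tauto

/-- After cutting the edge `i - p`, one of the two components stays inside the super leaf node of
`p`. -/
theorem IsGraft.component_subset (h : IsGraft T T' g) {l : Fin m} (hp : part g.p = some l)
    (hi : part g.i = some l ∨ part g.i = none)
    (hb : ∀ x x' z z', part x = some l → part x' = some l → part z ≠ some l → part z' ≠ some l →
      T.graph.Adj x z → T.graph.Adj x' z' → x = x' ∧ z = z') :
    (∀ v, (T.graph.deleteEdges {s(g.i, g.p)}).Reachable g.i v → part v = some l) ∨
      (∀ v, (T.graph.deleteEdges {s(g.i, g.p)}).Reachable g.p v → part v = some l) := by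
  set H := T.graph.deleteEdges {s(g.i, g.p)} with hH
  have hle : ∀ {u v}, H.Adj u v → T.graph.Adj u v := fun huv => (deleteEdges_adj.1 huv).1
  have leaving_edge : ∀ s, part s = some l → (¬ ∀ v, H.Reachable s v → part v = some l) →
      ∃ x z, H.Reachable s x ∧ H.Adj x z ∧ part x = some l ∧ part z ≠ some l := by
    intro s hs hex
    by_contra hcon
    push Not at hcon
    apply hex
    intro v hv
    refine (hv.mem_of_forall_adj (S := {x | H.Reachable s x ∧ part x = some l}) ?_
      ⟨Reachable.refl _, hs⟩).2
    rintro u ⟨hu, hul⟩ w huw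
    exact ⟨hu.trans huw.reachable, hcon u w hu huw hul⟩
  by_contra hcon
  push Not at hcon
  obtain ⟨⟨v, hv, hvl⟩, v', hv', hvl'⟩ := hcon
  obtain ⟨x, z, hsx, hxz, hx, hz⟩ := leaving_edge g.p hp fun hall => hvl' (hall v' hv')
  -- If `i` lies in the leaf, both components would leave it through the same boundary vertex and so
  -- be connected. If `i` is in the center, the only boundary edge is the deleted one.
  rcases hi with hi | hi
  · obtain ⟨x', z', hsx', hxz', hx', hz'⟩ := leaving_edge g.i hi fun hall => hvl (hall v hv)
    obtain ⟨rfl, -⟩ := hb x x' z z' hx hx' hz hz' (hle hxz) (hle hxz')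
    exact h.not_reachable (hsx'.trans hsx.symm)
  · obtain ⟨rfl, rfl⟩ := hb x g.p z g.i hx hp hz (by simp [hi]) (hle hxz) h.adj.symm
    rw [hH, deleteEdges_adj] at hxz
    exact hxz.2 (by simp [Sym2.eq_swap])

/-- The grafting operations of a chain do not change the edges at a super leaf node which is not
involved in them. -/
theorem adj_iff_of_chain {n : ℕ} {T : Fin (n + 1) → GaussianTree V} {g : Fin n → Graft V}
    (hstep : ∀ k : Fin n, IsGraft (T k.castSucc) (T k.succ) (g k)) (k : Fin (n + 1)) {l : Fin m}
    (hl : ∀ j : Fin n, j.castSucc < k → l ∉ (g j).leaves part) {u v : V} (hu : part u = some l) :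
    (T k).graph.Adj u v ↔ (T 0).graph.Adj u v := by
  induction k using Fin.induction with
  | zero => rfl
  | succ k ih =>
    have hk := hl k (Fin.castSucc_lt_succ)
    simp only [Graft.leaves, Set.mem_ofPred_eq, not_or] at hk
    rw [(hstep k).adj_iff (by rintro rfl; exact hk.1 hu) (by rintro rfl; exact hk.2.1 hu)
      (by rintro rfl; exact hk.2.2 hu)]
    exact ih fun j hj => hl j (hj.trans Fin.castSucc_lt_succ)

theorem Graft.part_of_isType {g : Graft V}
    (h : g.IsTypeOne part ∨ g.IsTypeTwo part ∨ g.IsTypeThree part) :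
    ∃ l, part g.p = some l ∧ (part g.i = some l ∨ part g.i = none) := by
  rcases h with ⟨l, hi, hp, -⟩ | ⟨l, hi, hp, -⟩ | ⟨l, -, -, hi, hp, -⟩
  · exact ⟨l, hp, .inl hi⟩
  · exact ⟨l, hp, .inr hi⟩
  · exact ⟨l, hp, .inl hi⟩

/-- The anchor nodes of the other operations avoid one of the components left by the cut. -/
theorem AreIndependent.anchors_avoid {n : ℕ} {T : Fin (n + 1) → GaussianTree V}
    {g : Fin n → Graft V} (hstep : ∀ k : Fin n, IsGraft (T k.castSucc) (T k.succ) (g k))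
    (hind : AreIndependent (T 0) g) (k : Fin n) :
    ∃ S : Set V,
      ((∀ v, ((T k.castSucc).graph.deleteEdges {s((g k).i, (g k).p)}).Reachable (g k).i v → v ∈ S) ∨
        ∀ v, ((T k.castSucc).graph.deleteEdges {s((g k).i, (g k).p)}).Reachable (g k).p v → v ∈ S) ∧
      (g k).p ∈ S ∧ ∀ j, j ≠ k → (g j).i ∉ S ∧ (g j).p ∉ S ∧ (g j).q ∉ S := by
  obtain ⟨m, part, hstar, htype, hdisj⟩ := hind
  obtain ⟨l, hp, hi⟩ := Graft.part_of_isType (htype k)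
  have hlk : l ∈ (g k).leaves part := Or.inr (Or.inl hp)
  have hlj : ∀ j, j ≠ k → l ∉ (g j).leaves part := fun j hj hlj =>
    Set.disjoint_left.1 (hdisj j k hj) hlj hlk
  -- The star shape is only given for the first tree; the boundary of this leaf is unchanged until
  -- the `k`-th operation.
  have hadj : ∀ {u v}, part u = some l →
      ((T k.castSucc).graph.Adj u v ↔ (T 0).graph.Adj u v) := fun hu =>
    adj_iff_of_chain hstep k.castSucc
      (fun j hj => hlj j (ne_of_lt (Fin.castSucc_lt_castSucc_iff.1 hj))) hu
  refine ⟨{v | part v = some l}, ?_, hp, fun j hj => ?_⟩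
  · refine (hstep k).component_subset hp hi ?_
    intro x x' z z' hx hx' hz hz' hxz hxz'
    exact hstar.boundary_unique (T 0).isTree hx hx' hz hz' ((hadj hx).1 hxz) ((hadj hx').1 hxz')
  · have := hlj j hj
    simpa only [Graft.leaves, Set.mem_ofPred_eq, not_or] using this

end Combinatorics

/-! ### Multiparameter interpolation along the chain. -/

section Chain

open Matrix

variable {V : Type*} [DecidableEq V]

/-- The change of the precision matrix under a grafting operation of weight `w`. -/
noncomputable def graftDiff (g : Graft V) (w : ℝ) : Matrix V V ℝ :=
  edgeTerm g.i g.p w - edgeTerm g.i g.q w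

theorem graftDiff_transpose (g : Graft V) (w : ℝ) : (graftDiff g w)ᵀ = graftDiff g w := by
  simp [graftDiff, edgeTerm_transpose]

variable [Fintype V]

theorem IsGraft.precision_source {T T' : GaussianTree V} {g : Graft V} (h : IsGraft T T' g) :
    precision T.edgeWeight = precision (T.restrict {s(g.i, g.p)}ᶜ).edgeWeight +
      edgeTerm g.i g.p (T.weight s(g.i, g.p)) := by
  rw [← T.edgeWeight_of_adj h.adj]
  refine precision_eq_add_edgeTerm h.adj.ne ?_ fun e he => ?_
  · simp [T.edgeWeight_restrict]
  · simp [T.edgeWeight_restrict, he]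

theorem IsGraft.precision_target {T T' : GaussianTree V} {g : Graft V} (h : IsGraft T T' g) :
    precision T'.edgeWeight = precision (T.restrict {s(g.i, g.p)}ᶜ).edgeWeight +
      edgeTerm g.i g.q (T.weight s(g.i, g.p)) := by
  have hadj : T'.graph.Adj g.i g.q := by
    rw [h.graph_eq, SimpleGraph.sup_adj, SimpleGraph.edge_adj]
    exact Or.inr ⟨Or.inl ⟨rfl, rfl⟩, h.source_ne_target⟩
  rw [← h.weight_new, ← T'.edgeWeight_of_adj hadj]
  refine precision_eq_add_edgeTerm h.source_ne_target ?_ fun e he => ?_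
  · rw [T.edgeWeight_restrict, Set.indicator_apply]
    split_ifs
    · exact T.edgeWeight_of_not_adj h.not_adj
    · rfl
  · rw [T.edgeWeight_restrict]
    induction e using Sym2.ind with
    | _ a b =>
    have hiff : T'.graph.Adj a b ↔ T.graph.Adj a b ∧ s(a, b) ≠ s(g.i, g.p) := by
      rw [h.graph_eq, SimpleGraph.sup_adj, SimpleGraph.deleteEdges_adj, SimpleGraph.edge_adj,
        Set.mem_singleton_iff]
      have h1 := fun hh => he (Sym2.eq_iff.2 hh)
      tauto
    by_cases hab : T'.graph.Adj a b
    · obtain ⟨h1, h2⟩ := hiff.1 hab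
      rw [Set.indicator_of_mem (by simpa using h2), T'.edgeWeight_of_adj hab,
        T.edgeWeight_of_adj h1]
      exact h.weight_old _ h1 h2
    · rw [T'.edgeWeight_of_not_adj hab, Set.indicator_apply]
      split_ifs with h2
      · exact (T.edgeWeight_of_not_adj fun h1 => hab (hiff.2 ⟨h1, h2⟩)).symm
      · rfl

variable {n : ℕ}

theorem graftDiff_mulVec_eq_zero {g : Graft V} {w : ℝ} {u : V → ℝ} (hi : u g.i = 0)
    (hp : u g.p = 0) (hq : u g.q = 0) : graftDiff g w *ᵥ u = 0 := by
  rw [graftDiff, sub_mulVec, edgeTerm_mulVec_eq_zero hi hp, edgeTerm_mulVec_eq_zero hi hq, sub_zero]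

/-- The interpolation between the precision matrices of the first and the last tree of a chain in
which the `j`-th grafting operation has the parameter `t j`. -/
noncomputable def interpolation (T : Fin (n + 1) → GaussianTree V) (g : Fin n → Graft V)
    (t : Fin n → ℝ) : Matrix V V ℝ :=
  precision (T (Fin.last n)).edgeWeight +
    ∑ j, t j • graftDiff (g j) ((T j.castSucc).weight s((g j).i, (g j).p))

variable {T : Fin (n + 1) → GaussianTree V} {g : Fin n → Graft V}

/-- Parameter `1` stands for an operation not yet performed, `0` for one already performed. -/
theorem precision_eq_interpolation
    (hstep : ∀ k : Fin n, IsGraft (T k.castSucc) (T k.succ) (g k)) (k : Fin (n + 1)) :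
    precision (T k).edgeWeight =
      interpolation T g fun j => if k ≤ j.castSucc then 1 else 0 := by
  induction k using Fin.reverseInduction with
  | last =>
    have : ∀ j : Fin n, ¬ Fin.last n ≤ j.castSucc := fun j => not_le.2 (Fin.castSucc_lt_last j)
    simp [interpolation, this]
  | cast k ih =>
    have h1 : precision (T k.castSucc).edgeWeight = precision (T k.succ).edgeWeight +
        graftDiff (g k) ((T k.castSucc).weight s((g k).i, (g k).p)) := by
      rw [(hstep k).precision_source, (hstep k).precision_target, graftDiff]
      abel
    rw [h1, ih, interpolation, interpolation, add_assoc]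
    congr 1
    have h2 : graftDiff (g k) ((T k.castSucc).weight s((g k).i, (g k).p)) =
        ∑ j, (if j = k then (1 : ℝ) else 0) •
          graftDiff (g j) ((T j.castSucc).weight s((g j).i, (g j).p)) := by
      simp
    rw [h2, ← Finset.sum_add_distrib]
    refine Finset.sum_congr rfl fun j _ => ?_
    rw [← add_smul]
    congr 1
    simp only [Fin.le_def, Fin.val_succ, Fin.val_castSucc, Fin.ext_iff]
    split_ifs <;> first | omega | norm_num

theorem interpolation_const (hstep : ∀ k : Fin n, IsGraft (T k.castSucc) (T k.succ) (g k))
    (t : ℝ) : interpolation T g (fun _ => t) =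
      t • precision (T 0).edgeWeight + (1 - t) • precision (T (Fin.last n)).edgeWeight := by
  rw [precision_eq_interpolation hstep 0]
  simp only [interpolation, Fin.zero_le, if_true, one_smul, ← Finset.smul_sum]
  module

/-- Isolating the `k`-th operation in the interpolation. -/
theorem interpolation_eq (hstep : ∀ k : Fin n, IsGraft (T k.castSucc) (T k.succ) (g k))
    (k : Fin n) (t : Fin n → ℝ) :
    interpolation T g t =
      (precision ((T k.castSucc).restrict {s((g k).i, (g k).p)}ᶜ).edgeWeight +
        ∑ j ∈ Finset.univ.erase k, (t j - if k.castSucc ≤ j.castSucc then 1 else 0) •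
          graftDiff (g j) ((T j.castSucc).weight s((g j).i, (g j).p))) +
      t k • edgeTerm (g k).i (g k).p ((T k.castSucc).weight s((g k).i, (g k).p)) +
      (1 - t k) • edgeTerm (g k).i (g k).q ((T k.castSucc).weight s((g k).i, (g k).p)) := by
  have h0 : interpolation T g t = precision (T k.castSucc).edgeWeight +
      ∑ j, (t j - if k.castSucc ≤ j.castSucc then 1 else 0) •
        graftDiff (g j) ((T j.castSucc).weight s((g j).i, (g j).p)) := by
    rw [precision_eq_interpolation hstep, interpolation, interpolation, add_assoc,
      ← Finset.sum_add_distrib]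
    congr 1
    refine Finset.sum_congr rfl fun j _ => ?_
    module
  rw [h0, (hstep k).precision_source, ← Finset.add_sum_erase _ _ (Finset.mem_univ k),
    if_pos le_rfl, graftDiff]
  module

theorem det_interpolation_update
    (hstep : ∀ k : Fin n, IsGraft (T k.castSucc) (T k.succ) (g k))
    (hind : AreIndependent (T 0) g) (k : Fin n) (t : Fin n → ℝ) :
    (interpolation T g (Function.update t k (1 - t k))).det = (interpolation T g t).det := by
  have hk := hstep k
  set w := (T k.castSucc).weight s((g k).i, (g k).p) with hw
  set R := (T k.castSucc).restrict {s((g k).i, (g k).p)}ᶜ with hR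
  set D : Fin n → Matrix V V ℝ := fun j =>
    graftDiff (g j) ((T j.castSucc).weight s((g j).i, (g j).p)) with hD
  set N := precision R.edgeWeight + ∑ j ∈ Finset.univ.erase k,
    (t j - if k.castSucc ≤ j.castSucc then 1 else 0) • D j with hNdef
  have e1 : interpolation T g t = N + t k • edgeTerm (g k).i (g k).p w +
      (1 - t k) • edgeTerm (g k).i (g k).q w := interpolation_eq hstep k t
  have e2 : interpolation T g (Function.update t k (1 - t k)) =
      N + (1 - t k) • edgeTerm (g k).i (g k).p w + t k • edgeTerm (g k).i (g k).q w := by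
    rw [interpolation_eq hstep k, Function.update_self, sub_sub_cancel, hNdef]
    congr 3
    refine Finset.sum_congr rfl fun j hj => ?_
    rw [Function.update_of_ne (Finset.ne_of_mem_erase hj)]
  rw [e1, e2]
  symm
  have hw1 : 1 - w ^ 2 ≠ 0 := by
    rw [hw, ← (T k.castSucc).edgeWeight_of_adj hk.adj]
    exact ((T k.castSucc).one_sub_sq_edgeWeight_pos _).ne'
  have hN : Nᵀ = N := by
    rw [hNdef, transpose_add, precision_transpose, transpose_sum]
    simp only [transpose_smul, hD, graftDiff_transpose]
  -- The other operations perturb `N` only at their anchors, so `N` acts on vectors vanishing there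
  -- as the precision matrix of the cut tree.
  have hmul : ∀ u : V → ℝ,
      (∀ j, j ≠ k → u (g j).i = 0 ∧ u (g j).p = 0 ∧ u (g j).q = 0) →
      N *ᵥ u = precision R.edgeWeight *ᵥ u := by
    intro u hu
    rw [hNdef, add_mulVec, sum_mulVec, Finset.sum_eq_zero, add_zero]
    intro j hj
    obtain ⟨h1, h2, h3⟩ := hu j (Finset.ne_of_mem_erase hj)
    rw [smul_mulVec, hD, graftDiff_mulVec_eq_zero h1 h2 h3, smul_zero]
  have hcol : ∀ c, precision R.edgeWeight *ᵥ R.cov.col c = Pi.single c 1 := by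
    intro c
    rw [← mulVec_single_one, mulVec_mulVec, R.precision_mul_cov, one_mulVec]
  have hpi := hk.not_reachable
  have hpq := hk.reachable
  obtain ⟨S, hS, -, hanch⟩ := hind.anchors_avoid hstep k
  rcases hS with hS | hS
  -- The component of `i` is untouched: its covariance column at `i` is supported there and serves
  -- as `a`.
  · have hz : ∀ v, v ∉ S → R.cov.col (g k).i v = 0 := fun v hv =>
      (T k.castSucc).cov_restrict_eq_zero fun hr => hv (hS v hr.symm)
    refine det_flip_of_source_side hN hw1 (a := R.cov.col (g k).i) ?_ (R.cov_self _) ?_ ?_ _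
    · rw [hmul _ fun j hj => ⟨hz _ (hanch j hj).1, hz _ (hanch j hj).2.1, hz _ (hanch j hj).2.2⟩,
        hcol]
    · exact (T k.castSucc).cov_restrict_eq_zero fun hr => hpi hr.symm
    · exact (T k.castSucc).cov_restrict_eq_zero fun hr => hpi (hpq.trans hr).symm
  -- The component of `p` and `q` is untouched: the difference of their columns is the vector of the
  -- reflection.
  · have hz : ∀ v, v ∉ S → (R.cov.col (g k).p - R.cov.col (g k).q) v = 0 := by
      intro v hv
      have h1 : R.cov v (g k).p = 0 :=
        (T k.castSucc).cov_restrict_eq_zero fun hr => hv (hS v hr.symm)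
      have h2 : R.cov v (g k).q = 0 :=
        (T k.castSucc).cov_restrict_eq_zero fun hr => hv (hS v (hpq.trans hr.symm))
      simp [h1, h2]
    refine det_flip_of_target_side hN hw1 (u := R.cov.col (g k).p - R.cov.col (g k).q) ?_ ?_ ?_ ?_ _
    · rw [hmul _ fun j hj => ⟨hz _ (hanch j hj).1, hz _ (hanch j hj).2.1, hz _ (hanch j hj).2.2⟩,
        mulVec_sub, hcol, hcol]
    · have h1 : R.cov (g k).i (g k).p = 0 := (T k.castSucc).cov_restrict_eq_zero hpi
      have h2 : R.cov (g k).i (g k).q = 0 :=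
        (T k.castSucc).cov_restrict_eq_zero fun hr => hpi (hr.trans hpq.symm)
      simp [h1, h2]
    · have := R.cov_lt_one hk.ne
      simp only [Pi.sub_apply, col_apply, R.cov_self]
      linarith
    · simp only [Pi.sub_apply, col_apply, R.cov_self, R.cov_comm (g k).q (g k).p]
      ring

theorem det_interpolation_one_sub
    (hstep : ∀ k : Fin n, IsGraft (T k.castSucc) (T k.succ) (g k))
    (hind : AreIndependent (T 0) g) (t : Fin n → ℝ) :
    (interpolation T g fun j => 1 - t j).det = (interpolation T g t).det := by
  have key : ∀ X : Finset (Fin n),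
      (interpolation T g fun j => if j ∈ X then 1 - t j else t j).det =
        (interpolation T g t).det := by
    intro X
    induction X using Finset.induction_on with
    | empty => simp
    | insert k X hk ih =>
      rw [← ih, ← det_interpolation_update hstep hind k]
      congr 2
      ext j
      by_cases hj : j = k
      · subst hj; simp [hk]
      · simp [hj]
  simpa using key Finset.univ

/-- No other operation has `p` as an anchor, so the `(i, p)` entry of the difference is `-w / (1 -
w²)`, coming from the `k`-th operation alone. -/
theorem precision_ne (hstep : ∀ k : Fin n, IsGraft (T k.castSucc) (T k.succ) (g k))
    (hind : AreIndependent (T 0) g) {k : Fin n}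
    (hk : (T k.castSucc).weight s((g k).i, (g k).p) ≠ 0) :
    precision (T 0).edgeWeight ≠ precision (T (Fin.last n)).edgeWeight := by
  intro h
  rw [precision_eq_interpolation hstep 0] at h
  simp only [interpolation, Fin.zero_le, if_true, one_smul, add_eq_left] at h
  obtain ⟨S, -, hpS, hanch⟩ := hind.anchors_avoid hstep k
  have h1 := congrFun (congrFun h (g k).i) (g k).p
  rw [Matrix.sum_apply, Finset.sum_eq_single k] at h1
  · have hip := (hstep k).adj.ne
    have hw := (T k.castSucc).one_sub_sq_edgeWeight_pos s((g k).i, (g k).p)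
    rw [(T k.castSucc).edgeWeight_of_adj (hstep k).adj] at hw
    simp [graftDiff, edgeTerm, Matrix.sub_apply, hip, hip.symm, (hstep k).ne, hk, hw.ne'] at h1
  · intro j _ hj
    obtain ⟨h1, h2, h3⟩ := hanch j hj
    have e1 : (g k).p ≠ (g j).i := fun he => h1 (he ▸ hpS)
    have e2 : (g k).p ≠ (g j).p := fun he => h2 (he ▸ hpS)
    have e3 : (g k).p ≠ (g j).q := fun he => h3 (he ▸ hpS)
    simp [graftDiff, edgeTerm, Matrix.sub_apply, e1, e2, e3]
  · simp

end Chain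

theorem proposition7 {V : Type*} [Fintype V] [DecidableEq V] {n : ℕ}
    (T : Fin (n + 1) → GaussianTree V) (g : Fin n → Graft V)
    (hstep : ∀ k : Fin n, IsGraft (T k.castSucc) (T k.succ) (g k))
    (hind : AreIndependent (T 0) g) :
    IsChernoffParameter (T 0).cov (T (Fin.last n)).cov (1 / 2) ∧
      ((∃ k : Fin n, (T k.castSucc).weight s((g k).i, (g k).p) ≠ 0) →
        ∀ t : ℝ, IsChernoffParameter (T 0).cov (T (Fin.last n)).cov t → t = 1 / 2) := by
  have hA := (T 0).posDef_precision
  have hB := (T (Fin.last n)).posDef_precision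
  rw [(T 0).cov_eq_inv_precision, (T (Fin.last n)).cov_eq_inv_precision]
  -- The segment between the two precision matrices is the diagonal of the parameter cube.
  have hsymm : ∀ t : ℝ, (t • precision (T 0).edgeWeight +
      (1 - t) • precision (T (Fin.last n)).edgeWeight).det =
      ((1 - t) • precision (T 0).edgeWeight + t • precision (T (Fin.last n)).edgeWeight).det := by
    intro t
    have := det_interpolation_one_sub hstep hind fun _ => t
    rw [interpolation_const hstep, interpolation_const hstep, sub_sub_cancel] at this
    exact this.symm
  have hhalf := isChernoffParameter_inv_half hA hB hsymm
  refine ⟨hhalf, ?_⟩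
  rintro ⟨k, hk⟩ t ht
  exact ht.inv_unique hA hB (by simpa using hsymm 1) (precision_ne hstep hind hk) hhalf
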